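/- **Setting.** Consider the Hopfield neural network on $\mathbb{R}^n$ $$\dot x = -\Lambda x + T g(x) + I(t) =: F_{\mathrm H}(t,x),$$ where $\Lambda$ is diagonal with positive diagonal entries, $T\in\mathbb{R}^{n\times n}$ is entrywise nonnegative and irreducible (its digraph is strongly connected), $I:\mathbb{R}_{\ge 0}\to\mathbb{R}^n_{\ge 0}$, and $g(x)=(g_1(x_1),\dots,g_n(x_n))^\top$, where each $g_i:\mathbb{R}\to\mathbb{R}$ is Lipschitz continuous and non-decreasing, $g_i(0)=0$, and $0\le \frac{g_i(x)-g_i(y)}{x-y}\le \overline G_i$ for all $x\ne y$, with constants $\overline G_i>0$. Let $[\overline G]=\mathrm{diag}(\overline G_1,\dots,\overline G_n)$ and assume that the Metzler matrix $-\Lambda+T[\overline G]$ is Hurwitz (all its eigenvalues have negative real part), with left and right Perron eigenpairs $(-c,v)$ and $(-c,w)$; that is, $-c$ is the eigenvalue of maximal real part and $v,w$ are nonzero nonnegative vectors with $v^\top(-\Lambda+T[\overline G])=-c\,v^\top$ and $(-\Lambda+T[\overline G])w=-c\,w$. For $p\in[1,\infty]$ and $q\in[1,\infty]$ with $\frac1p+\frac1q=1$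 (and $1/\infty=0$) put $\eta_i=v_i^{1/p}/w_i^{1/q}$ and $R=\mathrm{diag}(\eta_1,\dots,\eta_n)$, and let $\|x\|_{p,[\eta]}=\|Rx\|_p$, with the weak pairing $$[\![x,y]\!]_{p,[\eta]}=\begin{cases}\|Ry\|_1\,\mathrm{sign}(Ry)^\top Rx, & p=1,\\ \|Ry\|_p^{2-p}\,(Ry\circ|Ry|^{p-2})^\top Rx, & 1<p<\infty,\\ \max\{(Ry)_i(Rx)_i : |(Ry)_i|=\|Ry\|_\infty\}, & p=\infty\end{cases}$$ (for $1<p<\infty$ it is $0$ when $y=0$, and coordinates with $(Ry)_i=0$ contribute $0$). **Proposition (Strongly contracting Hopfield neural networks).** For every $p\in[1,\infty]$, one has $\eta_i>0$ for all $i$, and: 1. The network is strongly contracting with rate $c>0$ with respect to $\|\cdot\|_{p,[\eta]}$: for all $t\ge0$ and $x,y\in\mathbb{R}^n$, $$[\![F_{\mathrm H}(t,x)-F_{\mathrm H}(t,y),\,x-y]\!]_{p,[\eta]}\le -c\,\|x-y\|_{p,[\eta]}^2 .$$ 2. If $I(t)=I^*$ is constant, so that $F_{\mathrm H}=F_{\mathrm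 H}(x)$, the network has a unique equilibrium point $x^*$. It is globally exponentially stable: from every initial state there is a solution on $[0,\infty)$, and there are $K,a>0$ such that every solution on $[0,\infty)$ satisfies $\|x(t)-x^*\|\le Ke^{-at}\|x(0)-x^*\|$ for $t\ge 0$ (in any fixed norm on $\mathbb{R}^n$). Both $V(x)=\|x-x^*\|_{p,[\eta]}$ and $V(x)=\|F_{\mathrm H}(x)\|_{p,[\eta]}$ are global Lyapunov functions for $x^*$ with rate $c$: $V$ is continuous, $V(x^*)=0$, $V(x)>0$ for $x\ne x^*$, $V(x)\to\infty$ as $\|x\|\to\infty$, and along every solution on $[0,\infty)$ $$D^+V(x(t))=\limsup_{h\to0^+}\frac{V(x(t+h))-V(x(t))}{h}\le -c\,V(x(t)),\qquad t\ge 0.$$ -/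

import Mathlib

open Filter Topology
open scoped NNReal ENNReal Matrix

noncomputable section

/-- The weighted norm `‖x‖_{p,R} = ‖R x‖_p` on `ℝⁿ`. -/
def weightedNorm {n : ℕ} (p : ℝ≥0∞) (R : Matrix (Fin n) (Fin n) ℝ) (x : Fin n → ℝ) : ℝ :=
  ‖WithLp.toLp p (R *ᵥ x)‖

/-- The weak pairing `⟦x; y⟧_{p,R}` associated with `‖·‖_{p,R}`, for `p ∈ [1,∞]`:
* `p = 1`: `‖R y‖₁ sign(R y)ᵀ R x`;
* `p = ∞`: the maximum of `(R y)ᵢ (R x)ᵢ` over the indices with `|(R y)ᵢ| = ‖R y‖_∞`;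
* `1 < p < ∞`: `‖R y‖_p ^ (2 - p) (R y ∘ |R y| ^ (p - 2))ᵀ R x`. -/
def weakPairing {n : ℕ} (p : ℝ≥0∞) (R : Matrix (Fin n) (Fin n) ℝ) (x y : Fin n → ℝ) : ℝ :=
  if p = 1 then
    weightedNorm 1 R y * ∑ i, Real.sign ((R *ᵥ y) i) * (R *ᵥ x) i
  else if p = ∞ then
    ⨆ i : {i : Fin n // |(R *ᵥ y) i| = weightedNorm ∞ R y}, (R *ᵥ y) i * (R *ᵥ x) i
  else
    weightedNorm p R y ^ (2 - p.toReal) *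
      ∑ i, (R *ᵥ y) i * |(R *ᵥ y) i| ^ (p.toReal - 2) * (R *ᵥ x) i

/-- The time-varying vector field `f` on `ℝⁿ` is strongly contracting with rate `c > 0` with
respect to the norm `‖·‖_{p,R}` (and its weak pairing). -/
def IsStronglyContracting {n : ℕ} (f : ℝ≥0 → (Fin n → ℝ) → (Fin n → ℝ)) (p : ℝ≥0∞)
    (R : Matrix (Fin n) (Fin n) ℝ) (c : ℝ) : Prop :=
  0 < c ∧ ∀ (t : ℝ≥0) (x y : Fin n → ℝ),
    weakPairing p R (f t x - f t y) (x - y) ≤ -c * weightedNorm p R (x - y) ^ 2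

/-- `x` solves the autonomous system `ẋ = f(x)` on `[0, ∞)`. -/
def IsForwardSolution {n : ℕ} (f : (Fin n → ℝ) → (Fin n → ℝ)) (x : ℝ → Fin n → ℝ) : Prop :=
  ∀ t : ℝ, 0 ≤ t → HasDerivWithinAt x (f (x t)) (Set.Ici 0) t

/-- `xs` is a globally exponentially stable equilibrium of `ẋ = f(x)`: every initial state has a
solution on `[0, ∞)`, and all solutions converge to `xs` with a common exponential estimate
(all norms on `ℝⁿ` being equivalent, the choice of norm is immaterial). -/
structure IsGloballyExpStable {n : ℕ} (f : (Fin n → ℝ) → (Fin n → ℝ)) (xs : Fin n → ℝ) :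
    Prop where
  equilibrium : f xs = 0
  exists_solution : ∀ x₀ : Fin n → ℝ, ∃ x, IsForwardSolution f x ∧ x 0 = x₀
  decay : ∃ K a : ℝ, 0 < K ∧ 0 < a ∧ ∀ x, IsForwardSolution f x → ∀ t : ℝ, 0 ≤ t →
    ‖x t - xs‖ ≤ K * Real.exp (-a * t) * ‖x 0 - xs‖

/-- `V` is a global Lyapunov function with exponential rate `c` for the equilibrium `xs` of
`ẋ = f(x)`: it is continuous, positive definite about `xs`, radially unbounded, and along every
solution its upper right Dini derivative satisfies `D⁺ V(x(t)) ≤ -c V(x(t))`. -/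
structure IsGlobalExpLyapunov {n : ℕ} (f : (Fin n → ℝ) → (Fin n → ℝ)) (xs : Fin n → ℝ) (c : ℝ)
    (V : (Fin n → ℝ) → ℝ) : Prop where
  rate_pos : 0 < c
  continuous : Continuous V
  zero : V xs = 0
  pos : ∀ x, x ≠ xs → 0 < V x
  radially_unbounded : Tendsto V (cocompact (Fin n → ℝ)) atTop
  dini : ∀ x, IsForwardSolution f x → ∀ t : ℝ, 0 ≤ t → ∀ r : ℝ, -c * V (x t) < r →
    ∀ᶠ h in 𝓝[>] (0 : ℝ), (V (x (t + h)) - V (x t)) / h < r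

/-- All (complex) eigenvalues of `A` have negative real part. -/
def IsHurwitz {n : ℕ} (A : Matrix (Fin n) (Fin n) ℝ) : Prop :=
  ∀ z ∈ spectrum ℂ (A.map (algebraMap ℝ ℂ)), z.re < 0

/-- `(r, w)` is a right Perron eigenpair of the (Metzler) matrix `A`: `r` is an eigenvalue of
maximal real part, with the nonnegative nonzero eigenvector `w`. -/
structure IsRightPerronPair {n : ℕ} (A : Matrix (Fin n) (Fin n) ℝ) (r : ℝ) (w : Fin n → ℝ) :
    Prop where
  nonneg : ∀ i, 0 ≤ w i
  ne_zero : w ≠ 0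
  eigen : A *ᵥ w = r • w
  dominant : ∀ z ∈ spectrum ℂ (A.map (algebraMap ℝ ℂ)), z.re ≤ r

/-- `(r, v)` is a left Perron eigenpair of `A`, i.e. `vᵀ A = r vᵀ` etc. -/
def IsLeftPerronPair {n : ℕ} (A : Matrix (Fin n) (Fin n) ℝ) (r : ℝ) (v : Fin n → ℝ) : Prop :=
  IsRightPerronPair Aᵀ r v

/-- The standing assumptions on an activation function with sector bound `Gbar`. -/
structure IsActivation (g : ℝ → ℝ) (Gbar : ℝ) : Prop where
  lipschitz : ∃ K : ℝ≥0, LipschitzWith K g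
  monotone : Monotone g
  zero : g 0 = 0
  bound_pos : 0 < Gbar
  sector : ∀ x y, x ≠ y → 0 ≤ (g x - g y) / (x - y) ∧ (g x - g y) / (x - y) ≤ Gbar

/-- The Hopfield vector field `F_H(t, x) = -Λ x + T g(x) + I(t)`, with `Λ = diag(lam)` and
`g(x) = (g₁(x₁), …, gₙ(xₙ))`. -/
def hopfield {n : ℕ} (lam : Fin n → ℝ) (T : Matrix (Fin n) (Fin n) ℝ) (g : Fin n → ℝ → ℝ)
    (I : ℝ≥0 → Fin n → ℝ) (t : ℝ≥0) (x : Fin n → ℝ) : Fin n → ℝ :=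
  -(Matrix.diagonal lam *ᵥ x) + T *ᵥ (fun i => g i (x i)) + I t

/-- The weights `ηᵢ = vᵢ^{1/p} / wᵢ^{1/q}`, where `1/∞ = 0`. -/
def perronWeight {n : ℕ} (p q : ℝ≥0∞) (v w : Fin n → ℝ) (i : Fin n) : ℝ :=
  v i ^ (1 / p).toReal / w i ^ (1 / q).toReal

end

/-!
The argument rests on two Perron-type estimates for the Metzler matrix `A = -Λ + T [Ḡ]` and on
explicit Euler steps `Φ_h = id + h F`.

Irreducibility makes `v` and `w` positive, and the Hurwitz property makes `c` positive. The sector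
bounds show that the increments of the Hopfield field are dominated by `A` applied to `|x - y|`
(`sub_mul_hopfield_sub_le`), and those of a short Euler step by the nonnegative matrix `1 + h A`
(`abs_hopfield_euler_sub_le`). The latter has the positive eigenvectors `v` and `w` for the
eigenvalue `1 - c h`. The weights `vᵢ^{1/p} / wᵢ^{1/q}` are those of the Schur test: Young's
inequality is applied entry by entry (`sum_rpow_mul_mulVec_le`), so that one of the resulting sums
is evaluated by `w` and the other by `v`. The test gives `‖Φ_h x - Φ_h y‖ ≤ (1 - c h) ‖x - y‖`
(`weightedNorm_perronWeight_le_mul`), and its diagonal form gives the weak pairing inequality for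
finite `p` (`sum_rpow_mul_metzler_mulVec_le`); for `p = ∞` the maximal coordinate is estimated
directly.

Everything about the autonomous system follows from the contraction of `Φ_h`. Its unique fixed
point is the equilibrium `xs`. Since `x(t + h) = Φ_h(x(t)) + o(h)`, each Lipschitz function `V` with
`V ∘ Φ_h ≤ (1 - c h) V` has upper right Dini derivative at most `-c V` along solutions
(`IsForwardSolution.dini_of_euler_step`). This applies to `‖x - xs‖`, because `xs` is fixed by
`Φ_h`, and to `‖F x‖`, because `Φ_h(Φ_h x) - Φ_h x = h F(Φ_h x)` while `Φ_h x - x = h F x`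
(`norm_field_euler_step_le`), although `F` need not be differentiable. Radial unboundedness of
`‖F x‖` comes from `c ‖x - xs‖ ≤ ‖F x‖`. Grönwall's inequality turns the Dini estimate into
exponential decay, and the global Lipschitz bound yields solutions for all positive times by
joining Picard–Lindelöf solutions on intervals of a fixed length.
-/

/-! ### Global solutions of Lipschitz differential equations -/

section ODE

variable {E : Type*} [NormedAddCommGroup E] [NormedSpace ℝ E]

/-- The time for which the Picard–Lindelöf theorem yields a solution of `ẋ = F(x)` depends only on
the Lipschitz constant of `F`, not on the initial state. -/
theorem LipschitzWith.exists_integralCurve_Icc_short [CompleteSpace E] {F : E → E} {K : ℝ≥0}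
    (hF : LipschitzWith K F) (t₀ : ℝ) (x₀ : E) :
    ∃ α : ℝ → E, α t₀ = x₀ ∧ ∀ t ∈ Set.Icc t₀ (t₀ + (2 * (K + 1 : ℝ))⁻¹),
      HasDerivWithinAt α (F (α t)) (Set.Icc t₀ (t₀ + (2 * (K + 1 : ℝ))⁻¹)) t := by
  have hτ : (0 : ℝ) ≤ (2 * (K + 1 : ℝ))⁻¹ := by positivity
  let s : Set.Icc t₀ (t₀ + (2 * (K + 1 : ℝ))⁻¹) := ⟨t₀, by constructor <;> linarith⟩
  -- On the ball of radius `a = ‖F x₀‖` the field is bounded by `(K + 1) a`.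
  have hPL : IsPicardLindelof (fun _ => F) s x₀ ‖F x₀‖₊ 0 ((K + 1) * ‖F x₀‖₊) K := by
    apply IsPicardLindelof.of_time_independent
    · intro x hx
      have h1 : ‖F x - F x₀‖ ≤ K * ‖F x₀‖ := by
        refine (hF.norm_sub_le x x₀).trans ?_
        have : ‖x - x₀‖ ≤ ‖F x₀‖ := by simpa [dist_eq_norm] using hx
        gcongr
      have h2 := norm_add_le (F x - F x₀) (F x₀)
      rw [sub_add_cancel] at h2
      push_cast
      linarith
    · exact hF.lipschitzOnWith
    · have h1 : max (t₀ + (2 * (K + 1 : ℝ))⁻¹ - (s : ℝ)) ((s : ℝ) - t₀) = (2 * (K + 1 : ℝ))⁻¹ := by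
        simp only [s]
        rw [add_sub_cancel_left, sub_self, max_eq_left hτ]
      rw [h1]
      push_cast
      have : ((K : ℝ) + 1) * ‖F x₀‖ * (2 * (K + 1 : ℝ))⁻¹ = ‖F x₀‖ / 2 := by
        field_simp
      rw [this]
      linarith [norm_nonneg (F x₀)]
  exact hPL.exists_eq_forall_mem_Icc_hasDerivWithinAt₀

/-- Solutions on two adjacent intervals that agree at the common endpoint join to a solution. -/
theorem exists_integralCurve_Icc_union {F : E → E} {a b d : ℝ} (hab : a ≤ b) (hbd : b ≤ d)
    {α β : ℝ → E}
    (hα : ∀ t ∈ Set.Icc a b, HasDerivWithinAt α (F (α t)) (Set.Icc a b) t)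
    (hβ : ∀ t ∈ Set.Icc b d, HasDerivWithinAt β (F (β t)) (Set.Icc b d) t) (h : β b = α b) :
    ∃ γ : ℝ → E, γ a = α a ∧
      ∀ t ∈ Set.Icc a d, HasDerivWithinAt γ (F (γ t)) (Set.Icc a d) t := by
  classical
  let γ : ℝ → E := fun t => if t ≤ b then α t else β t
  have hγα : ∀ t ∈ Set.Icc a b, γ t = α t := fun t ht => if_pos ht.2
  have hγβ : ∀ t ∈ Set.Icc b d, γ t = β t := by
    intro t ht
    by_cases htb : t ≤ b
    · have : t = b := le_antisymm htb ht.1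
      simp [γ, this, h]
    · simp [γ, htb]
  refine ⟨γ, if_pos hab, fun t ht => ?_⟩
  rw [← Set.Icc_union_Icc_eq_Icc hab hbd]
  -- On a closed interval not containing `t`, differentiability within it at `t` is vacuous.
  apply HasDerivWithinAt.union
  · by_cases htb : t ∈ Set.Icc a b
    · rw [hγα t htb]
      exact (hα t htb).congr hγα (hγα t htb)
    · exact HasFDerivWithinAt.of_notMem_closure (by rwa [isClosed_Icc.closure_eq])
  · by_cases htb : t ∈ Set.Icc b d
    · rw [hγβ t htb]
      exact (hβ t htb).congr hγβ (hγβ t htb)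
    · exact HasFDerivWithinAt.of_notMem_closure (by rwa [isClosed_Icc.closure_eq])

theorem LipschitzWith.exists_integralCurve_Icc [CompleteSpace E] {F : E → E} {K : ℝ≥0}
    (hF : LipschitzWith K F) (x₀ : E) (k : ℕ) :
    ∃ α : ℝ → E, α 0 = x₀ ∧ ∀ t ∈ Set.Icc 0 (k * (2 * (K + 1 : ℝ))⁻¹),
      HasDerivWithinAt α (F (α t)) (Set.Icc 0 (k * (2 * (K + 1 : ℝ))⁻¹)) t := by
  induction k with
  | zero =>
    refine ⟨fun _ => x₀, rfl, fun t ht => ?_⟩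
    have : Set.Icc (0 : ℝ) ((0 : ℕ) * (2 * (K + 1 : ℝ))⁻¹) = {0} := by simp
    rw [this] at ht ⊢
    rw [Set.mem_singleton_iff.1 ht]
    exact HasFDerivWithinAt.of_subsingleton Set.subsingleton_singleton
  | succ k ih =>
    obtain ⟨α, hα0, hα⟩ := ih
    obtain ⟨β, hβ0, hβ⟩ := hF.exists_integralCurve_Icc_short (k * (2 * (K + 1 : ℝ))⁻¹)
      (α (k * (2 * (K + 1 : ℝ))⁻¹))
    obtain ⟨γ, hγ0, hγ⟩ := exists_integralCurve_Icc_union (by positivity)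
      (le_add_of_nonneg_right (by positivity)) hα hβ hβ0
    refine ⟨γ, hγ0.trans hα0, ?_⟩
    have : ((k + 1 : ℕ) : ℝ) * (2 * (K + 1 : ℝ))⁻¹
        = k * (2 * (K + 1 : ℝ))⁻¹ + (2 * (K + 1 : ℝ))⁻¹ := by push_cast; ring
    rwa [this]

/-- A differential equation with globally Lipschitz right-hand side has solutions on `[0, ∞)`. -/
theorem LipschitzWith.exists_integralCurve_Ici [CompleteSpace E] {F : E → E} {K : ℝ≥0}
    (hF : LipschitzWith K F) (x₀ : E) :
    ∃ x : ℝ → E, x 0 = x₀ ∧ ∀ t, 0 ≤ t → HasDerivWithinAt x (F (x t)) (Set.Ici 0) t := by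
  have hτ : (0 : ℝ) < (2 * (K + 1 : ℝ))⁻¹ := by positivity
  have key : ∀ k : ℕ, ∃ α : ℝ → E, α 0 = x₀ ∧ ∀ t ∈ Set.Icc 0 (k : ℝ),
      HasDerivWithinAt α (F (α t)) (Set.Icc 0 (k : ℝ)) t := by
    intro k
    obtain ⟨m, hm⟩ := exists_nat_ge ((k : ℝ) / (2 * (K + 1 : ℝ))⁻¹)
    rw [div_le_iff₀ hτ] at hm
    obtain ⟨α, h0, hα⟩ := hF.exists_integralCurve_Icc x₀ m
    exact ⟨α, h0, fun t ht => (hα t ⟨ht.1, ht.2.trans hm⟩).mono (Set.Icc_subset_Icc_right hm)⟩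
  choose α hα0 hα using key
  have hagree : ∀ k m : ℕ, k ≤ m → Set.EqOn (α k) (α m) (Set.Icc 0 (k : ℝ)) := by
    intro k m hkm
    have hkm' : (k : ℝ) ≤ m := by exact_mod_cast hkm
    have hsub : ∀ {b : ℝ} (t : ℝ), t < b → 0 ≤ t → Set.Icc 0 b ∈ 𝓝[≥] t := fun t htb ht =>
      mem_of_superset (Icc_mem_nhdsGE htb) (Set.Icc_subset_Icc_left ht)
    exact ODE_solution_unique_of_mem_Icc_right (v := fun _ => F) (s := fun _ => Set.univ) (K := K)
      (fun t _ => hF.lipschitzOnWith)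
      (fun t ht => (hα k t ht).continuousWithinAt)
      (fun t ht => (hα k t ⟨ht.1, ht.2.le⟩).mono_of_mem_nhdsWithin (hsub t ht.2 ht.1))
      (fun _ _ => Set.mem_univ _)
      (fun t ht => ((hα m t ⟨ht.1, ht.2.trans hkm'⟩).continuousWithinAt).mono
        (Set.Icc_subset_Icc_right hkm'))
      (fun t ht => (hα m t ⟨ht.1, ht.2.le.trans hkm'⟩).mono_of_mem_nhdsWithin
        (hsub t (ht.2.trans_le hkm') ht.1))
      (fun _ _ => Set.mem_univ _) ((hα0 k).trans (hα0 m).symm)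
  refine ⟨fun t => α ⌈t⌉₊ t, hα0 _, fun t ht => ?_⟩
  -- Near `t`, the glued curve coincides with the solution on `[0, ⌈t⌉ + 1]`.
  have hlt : t < ((⌈t⌉₊ + 1 : ℕ) : ℝ) := by
    push_cast
    linarith [Nat.le_ceil t]
  have heq : ∀ s ∈ Set.Icc 0 ((⌈t⌉₊ + 1 : ℕ) : ℝ), α ⌈s⌉₊ s = α (⌈t⌉₊ + 1) s := fun s hs =>
    hagree _ _ (Nat.ceil_le.2 hs.2) ⟨hs.1, Nat.le_ceil s⟩
  have hmem : t ∈ Set.Icc 0 ((⌈t⌉₊ + 1 : ℕ) : ℝ) := ⟨ht, hlt.le⟩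
  have h := (hα (⌈t⌉₊ + 1) t hmem).congr heq (heq t hmem)
  rw [← heq t hmem] at h
  refine h.mono_of_mem_nhdsWithin ?_
  rw [← Set.Ici_inter_Iic]
  exact inter_mem_nhdsWithin _ (Iic_mem_nhds hlt)

end ODE

/-! ### Vector fields with contracting Euler steps -/

/-- A Lipschitz function that decreases by the factor `1 - c h` along every short Euler step
`x ↦ x + h F(x)` has upper right Dini derivative at most `-c V` along the solutions of `ẋ = F(x)`. -/
theorem IsForwardSolution.dini_of_euler_step {n : ℕ} {F : (Fin n → ℝ) → (Fin n → ℝ)}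
    {V : (Fin n → ℝ) → ℝ} {M : ℝ≥0} (hV : LipschitzWith M V) {c h₀ : ℝ} (hh₀ : 0 < h₀)
    (hstep : ∀ h, 0 < h → h ≤ h₀ → ∀ y, V (y + h • F y) ≤ (1 - c * h) * V y)
    {x : ℝ → Fin n → ℝ} (hx : IsForwardSolution F x) {t : ℝ} (ht : 0 ≤ t) {r : ℝ}
    (hr : -c * V (x t) < r) :
    ∀ᶠ h in 𝓝[>] (0 : ℝ), (V (x (t + h)) - V (x t)) / h < r := by
  have hd : HasDerivWithinAt x (F (x t)) (Set.Ioi t) t :=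
    (hx t ht).mono (fun s hs => ht.trans (le_of_lt hs))
  set ε : ℝ := (r + c * V (x t)) / (2 * (M + 1)) with hε
  have hεpos : 0 < ε := by
    have : 0 < r + c * V (x t) := by linarith
    positivity
  have hMε : M * ε < r + c * V (x t) := by
    have h1 : 2 * ((M : ℝ) + 1) * ε = r + c * V (x t) := by rw [hε]; field_simp
    nlinarith [M.coe_nonneg]
  have hlo := hd.isLittleO.bound hεpos
  have htend : Tendsto (fun h : ℝ => t + h) (𝓝[>] 0) (𝓝[>] t) := by
    refine tendsto_nhdsWithin_iff.2 ⟨?_, ?_⟩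
    · have : Tendsto (fun h : ℝ => t + h) (𝓝 0) (𝓝 (t + 0)) :=
        (continuous_const.add continuous_id).tendsto 0
      rw [add_zero] at this
      exact this.mono_left nhdsWithin_le_nhds
    · filter_upwards [self_mem_nhdsWithin] with h hh
      exact lt_add_of_pos_right t hh
  filter_upwards [htend.eventually hlo, self_mem_nhdsWithin,
    mem_nhdsWithin_of_mem_nhds (Iic_mem_nhds hh₀)] with h h1 hpos hle
  have hpos' : (0 : ℝ) < h := hpos
  rw [add_sub_cancel_left, Real.norm_of_nonneg hpos'.le] at h1
  have h2 : V (x (t + h)) - V (x t + h • F (x t)) ≤ M * (ε * h) := by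
    refine (le_abs_self _).trans ((hV.norm_sub_le _ _).trans ?_)
    rw [← sub_sub]
    gcongr
  have h3 := hstep h hpos' hle (x t)
  rw [div_lt_iff₀ hpos']
  nlinarith

section EulerContraction

variable {n : ℕ} {E' : Type*} [NormedAddCommGroup E'] [NormedSpace ℝ E']
  {F : (Fin n → ℝ) → (Fin n → ℝ)} {S : (Fin n → ℝ) ≃L[ℝ] E'} {c h₀ : ℝ}

/-- A zero of `F` is a fixed point of an Euler step, so a contracting Euler step yields exactly
one zero. -/
theorem existsUnique_equilibrium_of_euler_contraction [CompleteSpace E'] (hc : 0 < c)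
    (hh₀ : 0 < h₀)
    (hstep : ∀ x y, ‖S ((x + h₀ • F x) - (y + h₀ • F y))‖ ≤ (1 - c * h₀) * ‖S (x - y)‖) :
    ∃ xs, ∀ x, F x = 0 ↔ x = xs := by
  let Φ : E' → E' := fun a => S (S.symm a + h₀ • F (S.symm a))
  have hΦ : ContractingWith (1 - c * h₀).toNNReal Φ := by
    refine ⟨?_, LipschitzWith.of_dist_le_mul fun a b => ?_⟩
    · have : 0 < c * h₀ := by positivity
      rw [← NNReal.coe_lt_coe, Real.coe_toNNReal']
      simp [this]
    · rw [dist_eq_norm, dist_eq_norm, ← map_sub]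
      refine (hstep _ _).trans ?_
      rw [map_sub, S.apply_symm_apply, S.apply_symm_apply]
      gcongr
      exact Real.le_coe_toNNReal _
  have hfix : ∀ x, F x = 0 ↔ Function.IsFixedPt Φ (S x) := by
    intro x
    simp [Function.IsFixedPt, Φ, hh₀.ne']
  refine ⟨S.symm (ContractingWith.fixedPoint Φ hΦ), fun x => ?_⟩
  rw [hfix, ContinuousLinearEquiv.eq_symm_apply]
  exact ⟨hΦ.fixedPoint_unique, fun h => h ▸ hΦ.fixedPoint_isFixedPt⟩

theorem tendsto_norm_continuousLinearEquiv_cocompact (S : (Fin n → ℝ) ≃L[ℝ] E') :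
    Tendsto (fun x => ‖S x‖) (cocompact (Fin n → ℝ)) atTop := by
  have : FiniteDimensional ℝ E' := S.toLinearEquiv.finiteDimensional
  have : ProperSpace E' := FiniteDimensional.proper_real E'
  exact (tendsto_norm_cocompact_atTop (E := E')).comp
    S.toHomeomorph.isClosedEmbedding.tendsto_cocompact

theorem lipschitzWith_norm_comp {G : (Fin n → ℝ) → (Fin n → ℝ)} {K : ℝ≥0}
    (hG : LipschitzWith K G) :
    LipschitzWith (1 * (‖(S : (Fin n → ℝ) →L[ℝ] E')‖₊ * K)) (fun x => ‖S (G x)‖) :=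
  lipschitzWith_one_norm.comp ((S : (Fin n → ℝ) →L[ℝ] E').lipschitz.comp hG)

theorem isGlobalExpLyapunov_norm_sub_of_euler_contraction (hc : 0 < c) (hh₀ : 0 < h₀)
    (hstep : ∀ h, 0 < h → h ≤ h₀ → ∀ x y,
      ‖S ((x + h • F x) - (y + h • F y))‖ ≤ (1 - c * h) * ‖S (x - y)‖)
    {xs : Fin n → ℝ} (hxs : F xs = 0) :
    IsGlobalExpLyapunov F xs c (fun x => ‖S (x - xs)‖) := by
  have hL := lipschitzWith_norm_comp (S := S)
    ((LipschitzWith.id (α := Fin n → ℝ)).sub (LipschitzWith.const xs))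
  refine ⟨hc, hL.continuous, by simp, fun x hx => ?_, ?_, fun x hx t ht r hr => ?_⟩
  · simpa [sub_eq_zero] using hx
  · exact (tendsto_norm_continuousLinearEquiv_cocompact S).comp
      (Homeomorph.subRight xs).isClosedEmbedding.tendsto_cocompact
  · refine hx.dini_of_euler_step hL hh₀ (fun h h0 h1 y => ?_) ht hr
    simpa [hxs] using hstep h h0 h1 y xs

/-- The increment of the Euler step `Φ = id + h F` along its own displacement is
`Φ(Φ(y)) - Φ(y) = h F(Φ(y))`, while `Φ(y) - y = h F(y)`: contraction of `Φ` makes `F` itself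
decrease. -/
theorem norm_field_euler_step_le (hstep : ∀ h, 0 < h → h ≤ h₀ → ∀ x y,
      ‖S ((x + h • F x) - (y + h • F y))‖ ≤ (1 - c * h) * ‖S (x - y)‖)
    {h : ℝ} (hpos : 0 < h) (hle : h ≤ h₀) (y : Fin n → ℝ) :
    ‖S (F (y + h • F y))‖ ≤ (1 - c * h) * ‖S (F y)‖ := by
  have h1 := hstep h hpos hle (y + h • F y) y
  rw [add_sub_cancel_left, add_sub_cancel_left, map_smul, map_smul, norm_smul, norm_smul,
    Real.norm_of_nonneg hpos.le] at h1
  refine le_of_mul_le_mul_left ?_ hpos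
  linarith

theorem mul_norm_sub_le_norm_field (hh₀ : 0 < h₀)
    (hstep : ∀ h, 0 < h → h ≤ h₀ → ∀ x y,
      ‖S ((x + h • F x) - (y + h • F y))‖ ≤ (1 - c * h) * ‖S (x - y)‖)
    {xs : Fin n → ℝ} (hxs : F xs = 0) (x : Fin n → ℝ) :
    c * ‖S (x - xs)‖ ≤ ‖S (F x)‖ := by
  have h1 := hstep h₀ hh₀ le_rfl x xs
  rw [hxs, smul_zero, add_zero, add_sub_right_comm, map_add, map_smul] at h1
  have h2 := norm_sub_le (S (x - xs) + h₀ • S (F x)) (h₀ • S (F x))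
  rw [add_sub_cancel_right, norm_smul, Real.norm_of_nonneg hh₀.le] at h2
  refine le_of_mul_le_mul_left ?_ hh₀
  linarith

theorem isGlobalExpLyapunov_norm_field_of_euler_contraction (hc : 0 < c) (hh₀ : 0 < h₀)
    (hstep : ∀ h, 0 < h → h ≤ h₀ → ∀ x y,
      ‖S ((x + h • F x) - (y + h • F y))‖ ≤ (1 - c * h) * ‖S (x - y)‖)
    {K : ℝ≥0} (hF : LipschitzWith K F) {xs : Fin n → ℝ} (hxs : F xs = 0) :
    IsGlobalExpLyapunov F xs c (fun x => ‖S (F x)‖) := by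
  have hL := lipschitzWith_norm_comp (S := S) hF
  have hV := isGlobalExpLyapunov_norm_sub_of_euler_contraction hc hh₀ hstep hxs
  have hlow := mul_norm_sub_le_norm_field hh₀ hstep hxs
  refine ⟨hc, hL.continuous, by simp [hxs], fun x hx => ?_, ?_, fun x hx t ht r hr => ?_⟩
  · exact (mul_pos hc (hV.pos x hx)).trans_le (hlow x)
  · exact tendsto_atTop_mono hlow (hV.radially_unbounded.const_mul_atTop hc)
  · exact hx.dini_of_euler_step hL hh₀
      (fun h h0 h1 y => norm_field_euler_step_le hstep h0 h1 y) ht hr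

end EulerContraction

/-- Grönwall's inequality for the Dini derivative of a Lyapunov function. -/
theorem IsGlobalExpLyapunov.le_exp_mul {n : ℕ} {F : (Fin n → ℝ) → (Fin n → ℝ)} {xs : Fin n → ℝ}
    {c : ℝ} {V : (Fin n → ℝ) → ℝ} (hV : IsGlobalExpLyapunov F xs c V) {x : ℝ → Fin n → ℝ}
    (hx : IsForwardSolution F x) {t : ℝ} (ht : 0 ≤ t) :
    V (x t) ≤ V (x 0) * Real.exp (-c * t) := by
  have hcont : ContinuousOn (fun s => V (x s)) (Set.Icc 0 t) :=
    hV.continuous.comp_continuousOn fun s hs =>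
      (hx s hs.1).continuousWithinAt.mono Set.Icc_subset_Ici_self
  have h := le_gronwallBound_of_liminf_deriv_right_le (f' := fun s => -c * V (x s)) (K := -c)
    (ε := 0) hcont (fun s hs r hr => ?_) le_rfl (fun s _ => by simp) t ⟨ht, le_rfl⟩
  · rwa [gronwallBound_ε0, sub_zero] at h
  · have htend : Tendsto (fun z : ℝ => z - s) (𝓝[>] s) (𝓝[>] 0) := by
      refine tendsto_nhdsWithin_iff.2 ⟨?_, ?_⟩
      · have : Tendsto (fun z : ℝ => z - s) (𝓝 s) (𝓝 (s - s)) :=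
          (continuous_id.sub continuous_const).tendsto s
        rw [sub_self] at this
        exact this.mono_left nhdsWithin_le_nhds
      · filter_upwards [self_mem_nhdsWithin] with z hz
        exact Set.mem_Ioi.2 (sub_pos.2 (Set.mem_Ioi.1 hz))
    refine ((htend.eventually (hV.dini x hx s hs.1 r hr)).mono fun z hz => ?_).frequently
    rwa [add_sub_cancel, div_eq_inv_mul] at hz

theorem isGloballyExpStable_of_isGlobalExpLyapunov {n : ℕ} {E' : Type*} [NormedAddCommGroup E']
    [NormedSpace ℝ E'] {F : (Fin n → ℝ) → (Fin n → ℝ)} {S : (Fin n → ℝ) ≃L[ℝ] E'} {c : ℝ}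
    {K : ℝ≥0} (hF : LipschitzWith K F) {xs : Fin n → ℝ} (hxs : F xs = 0)
    (hV : IsGlobalExpLyapunov F xs c (fun x => ‖S (x - xs)‖)) :
    IsGloballyExpStable F xs := by
  refine ⟨hxs, fun x₀ => ?_, ?_⟩
  · obtain ⟨x, h0, hx⟩ := hF.exists_integralCurve_Ici x₀
    exact ⟨x, hx, h0⟩
  · set a := ‖(S.symm : E' →L[ℝ] (Fin n → ℝ))‖
    set b := ‖(S : (Fin n → ℝ) →L[ℝ] E')‖
    refine ⟨a * b + 1, c, by positivity, hV.rate_pos, fun x hx t ht => ?_⟩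
    have h1 : ‖x t - xs‖ ≤ a * ‖S (x t - xs)‖ := by
      simpa using (S.symm : E' →L[ℝ] (Fin n → ℝ)).le_opNorm (S (x t - xs))
    have h2 : ‖S (x 0 - xs)‖ ≤ b * ‖x 0 - xs‖ :=
      (S : (Fin n → ℝ) →L[ℝ] E').le_opNorm _
    have h3 := hV.le_exp_mul hx ht
    calc ‖x t - xs‖ ≤ a * (b * ‖x 0 - xs‖ * Real.exp (-c * t)) := by
          refine h1.trans ?_
          gcongr
          exact h3.trans (by gcongr)
      _ = a * b * Real.exp (-c * t) * ‖x 0 - xs‖ := by ring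
      _ ≤ (a * b + 1) * Real.exp (-c * t) * ‖x 0 - xs‖ := by
          gcongr
          linarith

/-! ### Perron eigenvectors -/

section Perron

variable {n : ℕ}

/-- If `M` has nonnegative off-diagonal entries, the zeros of a nonnegative eigenvector spread
along the positive entries of `M`. -/
theorem eigenvector_eq_zero_of_entry_pos {M : Matrix (Fin n) (Fin n) ℝ} {r : ℝ} {u : Fin n → ℝ}
    (hM : ∀ i j, i ≠ j → 0 ≤ M i j) (hu : ∀ i, 0 ≤ u i) (heig : M *ᵥ u = r • u) {i j : Fin n}
    (hi : u i = 0) (hij : i ≠ j → 0 < M i j) : u j = 0 := by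
  by_cases h : i = j
  · rwa [← h]
  have hsum : ∑ k, M i k * u k = 0 := by
    have := congrFun heig i
    simpa [Matrix.mulVec, dotProduct, hi] using this
  have hnn : ∀ k ∈ Finset.univ, 0 ≤ M i k * u k := by
    intro k _
    by_cases hk : i = k
    · simp [← hk, hi]
    · exact mul_nonneg (hM i k hk) (hu k)
  have := (Finset.sum_eq_zero_iff_of_nonneg hnn).1 hsum j (Finset.mem_univ j)
  exact (mul_eq_zero.1 this).resolve_left (hij h).ne'

/-- A set of vertices of a strongly connected quiver that is closed under outgoing edges is
everything or empty. -/
theorem Quiver.IsStronglyConnected.forall_of_closed {V : Type*} [Quiver V]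
    (h : Quiver.IsStronglyConnected V) {P : V → Prop} (hP : ∀ {a b : V}, (a ⟶ b) → P a → P b)
    {a : V} (ha : P a) (b : V) : P b := by
  obtain ⟨p⟩ := h a b
  induction p with
  | nil => exact ha
  | cons _ e ih => exact hP e ih

theorem Quiver.IsStronglyConnected.forall_of_closed_reverse {V : Type*} [Quiver V]
    (h : Quiver.IsStronglyConnected V) {P : V → Prop} (hP : ∀ {a b : V}, (a ⟶ b) → P b → P a)
    {b : V} (hb : P b) (a : V) : P a := by
  obtain ⟨p⟩ := h a b
  induction p with
  | nil => exact hb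
  | cons _ e ih => exact ih (hP e hb)

theorem IsRightPerronPair.pos {A T : Matrix (Fin n) (Fin n) ℝ} {r : ℝ} {w : Fin n → ℝ}
    (hw : IsRightPerronPair A r w) (hT : @Quiver.IsStronglyConnected (Fin n) T.toQuiver)
    (hA : ∀ i j, i ≠ j → 0 ≤ A i j) (hTA : ∀ i j, i ≠ j → 0 < T i j → 0 < A i j) (i : Fin n) :
    0 < w i := by
  refine (hw.nonneg i).lt_of_ne fun hi => hw.ne_zero (funext ?_)
  let := T.toQuiver
  exact hT.forall_of_closed (P := fun j => w j = 0)
    (fun {a b} e ha => eigenvector_eq_zero_of_entry_pos hA hw.nonneg hw.eigen ha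
      fun hab => hTA a b hab e.down) hi.symm

theorem IsLeftPerronPair.pos {A T : Matrix (Fin n) (Fin n) ℝ} {r : ℝ} {v : Fin n → ℝ}
    (hv : IsLeftPerronPair A r v) (hT : @Quiver.IsStronglyConnected (Fin n) T.toQuiver)
    (hA : ∀ i j, i ≠ j → 0 ≤ A i j) (hTA : ∀ i j, i ≠ j → 0 < T i j → 0 < A i j) (i : Fin n) :
    0 < v i := by
  refine (hv.nonneg i).lt_of_ne fun hi => hv.ne_zero (funext ?_)
  let := T.toQuiver
  exact hT.forall_of_closed_reverse (P := fun j => v j = 0)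
    (fun {a b} e hb => eigenvector_eq_zero_of_entry_pos (M := Aᵀ)
      (fun i j hij => hA j i hij.symm) hv.nonneg hv.eigen hb
      fun hab => hTA a b hab.symm e.down) hi.symm

theorem IsRightPerronPair.mem_spectrum {A : Matrix (Fin n) (Fin n) ℝ} {r : ℝ} {w : Fin n → ℝ}
    (hw : IsRightPerronPair A r w) : (r : ℂ) ∈ spectrum ℂ (A.map (algebraMap ℝ ℂ)) := by
  rw [spectrum.mem_iff]
  intro hu
  have hinj := Matrix.mulVec_injective_of_isUnit hu
  have h0 : (algebraMap ℂ (Matrix (Fin n) (Fin n) ℂ) r - A.map (algebraMap ℝ ℂ)) *ᵥ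
      (fun i => (w i : ℂ)) = 0 := by
    have h1 : A.map (algebraMap ℝ ℂ) *ᵥ (fun i => (w i : ℂ)) = fun i => ((A *ᵥ w) i : ℂ) := by
      ext i
      simp [Matrix.mulVec, dotProduct]
    rw [Matrix.sub_mulVec, h1, hw.eigen, Algebra.algebraMap_eq_smul_one, Matrix.smul_mulVec,
      Matrix.one_mulVec]
    ext i
    simp
  refine hw.ne_zero (funext fun i => ?_)
  have := congrFun (hinj (h0.trans (Matrix.mulVec_zero _).symm)) i
  simpa using this

end Perron

/-! ### Nonnegative matrices in weighted norms -/

section Schur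

variable {n : ℕ}

/-- Young's inequality in the form used for weak pairings; it includes `P = 1`, where `0 ^ 0 = 1`. -/
theorem rpow_sub_one_mul_le {P s b : ℝ} (hP : 1 ≤ P) (hs : 0 ≤ s) (hb : 0 ≤ b) :
    s ^ (P - 1) * b ≤ (P - 1) / P * s ^ P + 1 / P * b ^ P := by
  have hP0 : 0 < P := by linarith
  have h := Real.geom_mean_le_arith_mean2_weighted (w₁ := (P - 1) / P) (w₂ := 1 / P)
    (p₁ := s ^ P) (p₂ := b ^ P) (div_nonneg (by linarith) hP0.le) (by positivity) (by positivity)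
    (by positivity) (by field_simp; ring)
  rwa [← Real.rpow_mul hs, ← Real.rpow_mul hb, mul_div_cancel₀ _ hP0.ne',
    mul_div_cancel₀ _ hP0.ne', Real.rpow_one] at h

/-- The Schur test, in polarized form: Young's inequality applied to each entry, with `w` summed
out by `M w = ρ w` in one term and `v` by `vᵀ M = ρ vᵀ` in the other. -/
theorem sum_rpow_mul_mulVec_le {M : Matrix (Fin n) (Fin n) ℝ} {ρ : ℝ} {v w : Fin n → ℝ}
    (hM : ∀ i j, 0 ≤ M i j) (hv : ∀ i, 0 ≤ v i) (hw : ∀ i, 0 ≤ w i)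
    (hMw : M *ᵥ w = ρ • w) (hMv : Mᵀ *ᵥ v = ρ • v) {P : ℝ} (hP : 1 ≤ P) {s b : Fin n → ℝ}
    (hs : ∀ i, 0 ≤ s i) (hb : ∀ i, 0 ≤ b i) :
    ∑ i, v i * s i ^ (P - 1) * (M *ᵥ (w * b)) i ≤
      ρ * ((P - 1) / P * ∑ i, v i * w i * s i ^ P + 1 / P * ∑ i, v i * w i * b i ^ P) := by
  have hrow : ∀ i, ∑ j, M i j * w j = ρ * w i := fun i => congrFun hMw i
  have hcol : ∀ j, ∑ i, M i j * v i = ρ * v j := fun j => congrFun hMv j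
  calc ∑ i, v i * s i ^ (P - 1) * (M *ᵥ (w * b)) i
      = ∑ i, ∑ j, v i * M i j * w j * (s i ^ (P - 1) * b j) := by
        refine Finset.sum_congr rfl fun i _ => ?_
        rw [Matrix.mulVec, dotProduct, Finset.mul_sum]
        refine Finset.sum_congr rfl fun j _ => ?_
        rw [Pi.mul_apply]
        ring
    _ ≤ ∑ i, ∑ j, v i * M i j * w j * ((P - 1) / P * s i ^ P + 1 / P * b j ^ P) := by
        refine Finset.sum_le_sum fun i _ => Finset.sum_le_sum fun j _ => ?_
        exact mul_le_mul_of_nonneg_left (rpow_sub_one_mul_le hP (hs i) (hb j))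
          (mul_nonneg (mul_nonneg (hv i) (hM i j)) (hw j))
    _ = (P - 1) / P * ∑ i, v i * s i ^ P * ∑ j, M i j * w j +
        1 / P * ∑ j, w j * b j ^ P * ∑ i, M i j * v i := by
        simp only [mul_add, Finset.sum_add_distrib, Finset.mul_sum]
        congr 1
        · exact Finset.sum_congr rfl fun i _ => Finset.sum_congr rfl fun j _ => by ring
        · rw [Finset.sum_comm]
          exact Finset.sum_congr rfl fun i _ => Finset.sum_congr rfl fun j _ => by ring
    _ = _ := by
        simp only [hrow, hcol, Finset.mul_sum, mul_add]
        congr 1 <;> exact Finset.sum_congr rfl fun i _ => by ring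

/-- The Schur test: in the variables `b = a / w`, the matrix `M` has norm at most `ρ` on the
weighted `ℓᴾ` space. -/
theorem sum_rpow_le_of_le_mulVec {M : Matrix (Fin n) (Fin n) ℝ} {ρ : ℝ} {v w : Fin n → ℝ}
    (hρ : 0 < ρ) (hM : ∀ i j, 0 ≤ M i j) (hv : ∀ i, 0 ≤ v i) (hw : ∀ i, 0 < w i)
    (hMw : M *ᵥ w = ρ • w) (hMv : Mᵀ *ᵥ v = ρ • v) {P : ℝ} (hP : 1 ≤ P) {a b : Fin n → ℝ}
    (ha : ∀ i, 0 ≤ a i) (hb : ∀ i, 0 ≤ b i) (hab : ∀ i, w i * a i ≤ (M *ᵥ (w * b)) i) :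
    ∑ i, v i * w i * a i ^ P ≤ ρ ^ P * ∑ i, v i * w i * b i ^ P := by
  have hP0 : 0 < P := by linarith
  -- The factor `ρ` is split off so that the polarized inequality becomes `X ≤ (1-1/P) X + Y/P`.
  set s : Fin n → ℝ := fun i => a i / ρ
  have hs : ∀ i, 0 ≤ s i := fun i => div_nonneg (ha i) hρ.le
  have hpol := sum_rpow_mul_mulVec_le hM hv (fun i => (hw i).le) hMw hMv hP hs hb
  have hlow : ρ * ∑ i, v i * w i * s i ^ P ≤ ∑ i, v i * s i ^ (P - 1) * (M *ᵥ (w * b)) i := by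
    rw [Finset.mul_sum]
    refine Finset.sum_le_sum fun i _ => ?_
    have h1 : s i ^ P = s i ^ (P - 1) * s i := by
      rw [← Real.rpow_add_one' (hs i) (by linarith), sub_add_cancel]
    have h2 : ρ * s i = a i := mul_div_cancel₀ _ hρ.ne'
    calc ρ * (v i * w i * s i ^ P) = v i * s i ^ (P - 1) * (w i * (ρ * s i)) := by rw [h1]; ring
      _ ≤ _ := by
        rw [h2]
        exact mul_le_mul_of_nonneg_left (hab i) (mul_nonneg (hv i) (Real.rpow_nonneg (hs i) _))
  have hkey := le_of_mul_le_mul_left (hlow.trans hpol) hρ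
  have hle : ∑ i, v i * w i * s i ^ P ≤ ∑ i, v i * w i * b i ^ P := by
    have h1 : (P - 1) / P = 1 - 1 / P := by field_simp
    rw [h1] at hkey
    have h2 : 0 < 1 / P := by positivity
    refine le_of_mul_le_mul_left ?_ h2
    linarith
  calc ∑ i, v i * w i * a i ^ P = ρ ^ P * ∑ i, v i * w i * s i ^ P := by
        rw [Finset.mul_sum]
        refine Finset.sum_congr rfl fun i _ => ?_
        rw [Real.div_rpow (ha i) hρ.le]
        have : ρ ^ P ≠ 0 := (Real.rpow_pos_of_pos hρ P).ne'
        field_simp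
    _ ≤ _ := mul_le_mul_of_nonneg_left hle (Real.rpow_nonneg hρ.le P)

theorem mulVec_le_of_le {M : Matrix (Fin n) (Fin n) ℝ} {ρ C : ℝ} {w : Fin n → ℝ}
    (hM : ∀ i j, 0 ≤ M i j) (hMw : M *ᵥ w = ρ • w) {a : Fin n → ℝ}
    (ha : ∀ i, a i ≤ C * w i) (i : Fin n) : (M *ᵥ a) i ≤ ρ * (C * w i) := by
  have hrow : ∑ j, M i j * w j = ρ * w i := congrFun hMw i
  calc (M *ᵥ a) i = ∑ j, M i j * a j := rfl
    _ ≤ ∑ j, M i j * (C * w j) :=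
        Finset.sum_le_sum fun j _ => mul_le_mul_of_nonneg_left (ha j) (hM i j)
    _ = C * ∑ j, M i j * w j := by
        rw [Finset.mul_sum]
        exact Finset.sum_congr rfl fun j _ => by ring
    _ = _ := by rw [hrow]; ring

end Schur

/-! ### Norms weighted by Perron eigenvectors -/

section PerronNorm

variable {n : ℕ} {p q : ℝ≥0∞} {v w : Fin n → ℝ}

theorem perronWeight_pos (hv : ∀ i, 0 < v i) (hw : ∀ i, 0 < w i) (i : Fin n) :
    0 < perronWeight p q v w i :=
  div_pos (Real.rpow_pos_of_pos (hv i) _) (Real.rpow_pos_of_pos (hw i) _)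

theorem perronWeight_top (hpq : 1 / ∞ + 1 / q = 1) (i : Fin n) :
    perronWeight ∞ q v w i = 1 / w i := by
  have hq : 1 / q = 1 := by simpa using hpq
  simp only [perronWeight, hq]
  simp

theorem perronWeight_rpow (hp : 1 ≤ p) (hpt : p ≠ ∞) (hpq : 1 / p + 1 / q = 1)
    (hv : ∀ i, 0 < v i) (hw : ∀ i, 0 < w i) (i : Fin n) :
    perronWeight p q v w i ^ p.toReal = v i / w i ^ (p.toReal - 1) := by
  have hP : 1 ≤ p.toReal := by
    simpa using (ENNReal.toReal_le_toReal ENNReal.one_ne_top hpt).2 hp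
  have hp1 : (1 / p).toReal = 1 / p.toReal := by simp
  have hpt' : 1 / p ≠ ∞ := by
    simp only [one_div, ne_eq, ENNReal.inv_eq_top]
    exact (zero_lt_one.trans_le hp).ne'
  have hqt : 1 / q ≠ ∞ := fun h => by simp [h] at hpq
  have hq1 : (1 / q).toReal = 1 - 1 / p.toReal := by
    have := congrArg ENNReal.toReal hpq
    rw [ENNReal.toReal_add hpt' hqt, hp1, ENNReal.toReal_one] at this
    linarith
  have hP0 : p.toReal ≠ 0 := by linarith
  rw [perronWeight, hp1, hq1, Real.div_rpow (Real.rpow_nonneg (hv i).le _)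
    (Real.rpow_nonneg (hw i).le _), ← Real.rpow_mul (hv i).le, ← Real.rpow_mul (hw i).le]
  congr 2
  · field_simp
    simp
  · field_simp

theorem weightedNorm_rpow_eq_sum {η x : Fin n → ℝ} (hp : 1 ≤ p) (hpt : p ≠ ∞) :
    weightedNorm p (Matrix.diagonal η) x ^ p.toReal = ∑ i, |η i * x i| ^ p.toReal := by
  have hP0 : 0 < p.toReal := ENNReal.toReal_pos (zero_lt_one.trans_le hp).ne' hpt
  rw [weightedNorm, PiLp.norm_eq_sum hP0, ← Real.rpow_mul (by positivity),
    one_div_mul_cancel hP0.ne', Real.rpow_one]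
  simp [Matrix.mulVec_diagonal]

theorem weightedNorm_perronWeight_rpow (hp : 1 ≤ p) (hpt : p ≠ ∞) (hpq : 1 / p + 1 / q = 1)
    (hv : ∀ i, 0 < v i) (hw : ∀ i, 0 < w i) (x : Fin n → ℝ) :
    weightedNorm p (Matrix.diagonal (perronWeight p q v w)) x ^ p.toReal =
      ∑ i, v i * w i * (|x i| / w i) ^ p.toReal := by
  rw [weightedNorm_rpow_eq_sum hp hpt]
  refine Finset.sum_congr rfl fun i _ => ?_
  have hη := (perronWeight_pos (p := p) (q := q) hv hw i).le
  rw [abs_mul, abs_of_nonneg hη, Real.mul_rpow hη (abs_nonneg _),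
    perronWeight_rpow hp hpt hpq hv hw, Real.div_rpow (abs_nonneg _) (hw i).le,
    Real.rpow_sub_one (hw i).ne']
  have := (Real.rpow_pos_of_pos (hw i) p.toReal).ne'
  have := (hw i).ne'
  field_simp

theorem weightedNorm_nonneg (hp : 1 ≤ p) (R : Matrix (Fin n) (Fin n) ℝ) (x : Fin n → ℝ) :
    0 ≤ weightedNorm p R x := by
  have : Fact (1 ≤ p) := ⟨hp⟩
  exact norm_nonneg _

theorem abs_le_weightedNorm_top {η x : Fin n → ℝ} (i : Fin n) :
    |η i * x i| ≤ weightedNorm ∞ (Matrix.diagonal η) x := by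
  have := PiLp.norm_apply_le (WithLp.toLp ∞ (Matrix.diagonal η *ᵥ x)) i
  simpa [Matrix.mulVec_diagonal, weightedNorm] using this

theorem weightedNorm_top_le {η x : Fin n → ℝ} {C : ℝ} (hC : 0 ≤ C) (h : ∀ i, |η i * x i| ≤ C) :
    weightedNorm ∞ (Matrix.diagonal η) x ≤ C := by
  rw [weightedNorm, PiLp.norm_eq_ciSup]
  refine Real.iSup_le (fun i => ?_) hC
  simpa [Matrix.mulVec_diagonal] using h i

theorem exists_abs_eq_weightedNorm_top [Nonempty (Fin n)] (R : Matrix (Fin n) (Fin n) ℝ)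
    (x : Fin n → ℝ) : ∃ i, |(R *ᵥ x) i| = weightedNorm ∞ R x := by
  rw [weightedNorm, PiLp.norm_eq_ciSup]
  exact exists_eq_ciSup_of_finite

/-- A weighted norm with positive diagonal weight is the `ℓᵖ` norm in rescaled coordinates. -/
theorem exists_continuousLinearEquiv_weightedNorm [Fact (1 ≤ p)] {η : Fin n → ℝ}
    (hη : ∀ i, 0 < η i) :
    ∃ S : (Fin n → ℝ) ≃L[ℝ] PiLp p (fun _ : Fin n => ℝ),
      ∀ x, weightedNorm p (Matrix.diagonal η) x = ‖S x‖ := by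
  have hdet : IsUnit (Matrix.diagonal η).det := by
    rw [Matrix.det_diagonal, isUnit_iff_ne_zero, Finset.prod_ne_zero_iff]
    exact fun i _ => (hη i).ne'
  let := Matrix.invertibleOfIsUnitDet _ hdet
  exact ⟨((Matrix.toLinearEquiv' (Matrix.diagonal η) inferInstance).toContinuousLinearEquiv).trans
    (PiLp.continuousLinearEquiv p ℝ (fun _ : Fin n => ℝ)).symm, fun x => rfl⟩

/-- A linear map dominated entrywise by a nonnegative matrix with Perron eigenvalue `ρ` has norm
at most `ρ` in the Perron-weighted norm. -/
theorem weightedNorm_perronWeight_le_mul (hp : 1 ≤ p) (hpq : 1 / p + 1 / q = 1)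
    (hv : ∀ i, 0 < v i) (hw : ∀ i, 0 < w i) {M : Matrix (Fin n) (Fin n) ℝ} {ρ : ℝ} (hρ : 0 < ρ)
    (hM : ∀ i j, 0 ≤ M i j) (hMw : M *ᵥ w = ρ • w) (hMv : Mᵀ *ᵥ v = ρ • v) {x y : Fin n → ℝ}
    (hxy : ∀ i, |x i| ≤ (M *ᵥ fun j => |y j|) i) :
    weightedNorm p (Matrix.diagonal (perronWeight p q v w)) x ≤
      ρ * weightedNorm p (Matrix.diagonal (perronWeight p q v w)) y := by
  by_cases hpt : p = ∞
  · subst hpt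
    set N := weightedNorm ∞ (Matrix.diagonal (perronWeight ∞ q v w)) y
    have hN : 0 ≤ N := weightedNorm_nonneg hp _ _
    refine weightedNorm_top_le (mul_nonneg hρ.le hN) fun i => ?_
    have hy : ∀ j, |y j| ≤ N * w j := by
      intro j
      have := abs_le_weightedNorm_top (η := perronWeight ∞ q v w) (x := y) j
      rw [perronWeight_top hpq, one_div_mul_eq_div, abs_div, abs_of_pos (hw j),
        div_le_iff₀ (hw j)] at this
      exact this
    rw [perronWeight_top hpq, one_div_mul_eq_div, abs_div, abs_of_pos (hw i), div_le_iff₀ (hw i),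
      mul_assoc]
    exact (hxy i).trans (mulVec_le_of_le hM hMw hy i)
  · have hP : 1 ≤ p.toReal := by
      simpa using (ENNReal.toReal_le_toReal ENNReal.one_ne_top hpt).2 hp
    have hny := weightedNorm_nonneg hp (Matrix.diagonal (perronWeight p q v w)) y
    have hnx := weightedNorm_nonneg hp (Matrix.diagonal (perronWeight p q v w)) x
    rw [← Real.rpow_le_rpow_iff hnx (mul_nonneg hρ.le hny) (z := p.toReal) (by linarith),
      Real.mul_rpow hρ.le hny, weightedNorm_perronWeight_rpow hp hpt hpq hv hw,
      weightedNorm_perronWeight_rpow hp hpt hpq hv hw]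
    refine sum_rpow_le_of_le_mulVec hρ hM (fun i => (hv i).le) hw hMw hMv hP
      (fun i => div_nonneg (abs_nonneg _) (hw i).le)
      (fun i => div_nonneg (abs_nonneg _) (hw i).le) fun i => ?_
    have hwy : (w * fun j => |y j| / w j) = fun j => |y j| :=
      funext fun j => mul_div_cancel₀ _ (hw j).ne'
    rw [mul_div_cancel₀ _ (hw i).ne', hwy]
    exact hxy i

end PerronNorm

/-! ### Weak pairings and Metzler matrices -/

section Metzler

variable {n : ℕ} {A : Matrix (Fin n) (Fin n) ℝ} {c : ℝ} {v w : Fin n → ℝ}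

theorem one_add_smul_mulVec_eigen (hAw : A *ᵥ w = (-c) • w) (h : ℝ) :
    (1 + h • A) *ᵥ w = (1 - c * h) • w := by
  rw [Matrix.add_mulVec, Matrix.one_mulVec, Matrix.smul_mulVec, hAw]
  module

theorem one_add_smul_transpose_mulVec_eigen (hAv : Aᵀ *ᵥ v = (-c) • v) (h : ℝ) :
    (1 + h • A)ᵀ *ᵥ v = (1 - c * h) • v := by
  rw [Matrix.transpose_add, Matrix.transpose_one, Matrix.transpose_smul,
    one_add_smul_mulVec_eigen hAv]

/-- A Metzler matrix `A` becomes nonnegative as `1 + h A` with `h` small. -/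
theorem exists_forall_one_add_smul_nonneg (hA : ∀ i j, i ≠ j → 0 ≤ A i j) :
    ∃ h : ℝ, 0 < h ∧ ∀ i j, 0 ≤ (1 + h • A) i j := by
  have hS : 0 ≤ ∑ i, |A i i| := Finset.sum_nonneg fun i _ => abs_nonneg _
  refine ⟨1 / (1 + ∑ i, |A i i|), by positivity, fun i j => ?_⟩
  by_cases hij : i = j
  · subst hij
    have h1 : |A i i| ≤ ∑ i, |A i i| :=
      Finset.single_le_sum (f := fun i => |A i i|) (fun i _ => abs_nonneg _) (Finset.mem_univ i)
    have h2 := neg_abs_le (A i i)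
    simp only [Matrix.add_apply, Matrix.one_apply_eq, Matrix.smul_apply, smul_eq_mul]
    have h3 : 1 + 1 / (1 + ∑ i, |A i i|) * A i i
        = (1 + ∑ i, |A i i| + A i i) / (1 + ∑ i, |A i i|) := by field_simp
    rw [h3]
    exact div_nonneg (by linarith) (by linarith)
  · simp only [Matrix.add_apply, Matrix.one_apply_ne hij, zero_add, Matrix.smul_apply,
      smul_eq_mul]
    exact mul_nonneg (by positivity) (hA i j hij)

/-- The polarized Schur test on the diagonal, for a Metzler matrix: subtracting `∑ vᵢ wᵢ sᵢᴾ` from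
both sides of the test for `1 + h A` leaves `h` times the claim. -/
theorem sum_rpow_mul_metzler_mulVec_le (hA : ∀ i j, i ≠ j → 0 ≤ A i j) (hv : ∀ i, 0 ≤ v i)
    (hw : ∀ i, 0 ≤ w i) (hAw : A *ᵥ w = (-c) • w) (hAv : Aᵀ *ᵥ v = (-c) • v) {P : ℝ} (hP : 1 ≤ P)
    {s : Fin n → ℝ} (hs : ∀ i, 0 ≤ s i) :
    ∑ i, v i * s i ^ (P - 1) * (A *ᵥ (w * s)) i ≤ -c * ∑ i, v i * w i * s i ^ P := by
  obtain ⟨h, hpos, hM⟩ := exists_forall_one_add_smul_nonneg hA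
  have key := sum_rpow_mul_mulVec_le hM hv hw (one_add_smul_mulVec_eigen hAw h)
    (one_add_smul_transpose_mulVec_eigen hAv h) hP hs hs
  have hP0 : P ≠ 0 := by linarith
  have hleft : ∑ i, v i * s i ^ (P - 1) * ((1 + h • A) *ᵥ (w * s)) i =
      ∑ i, v i * w i * s i ^ P + h * ∑ i, v i * s i ^ (P - 1) * (A *ᵥ (w * s)) i := by
    rw [Finset.mul_sum, ← Finset.sum_add_distrib]
    refine Finset.sum_congr rfl fun i _ => ?_
    have h1 : s i ^ P = s i ^ (P - 1) * s i := by
      rw [← Real.rpow_add_one' (hs i) (by linarith), sub_add_cancel]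
    rw [Matrix.add_mulVec, Matrix.one_mulVec, Matrix.smul_mulVec, Pi.add_apply, Pi.mul_apply,
      Pi.smul_apply, smul_eq_mul, h1]
    ring
  have hright : (1 - c * h) * ((P - 1) / P * ∑ i, v i * w i * s i ^ P +
      1 / P * ∑ i, v i * w i * s i ^ P) = (1 - c * h) * ∑ i, v i * w i * s i ^ P := by
    field_simp
    ring
  rw [hleft, hright] at key
  refine le_of_mul_le_mul_left ?_ hpos
  linarith

variable {p q : ℝ≥0∞} {d Δ : Fin n → ℝ}

theorem weakPairing_one_perronWeight_le (hq : 1 / (1 : ℝ≥0∞) + 1 / q = 1) (hv : ∀ i, 0 < v i)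
    (hw : ∀ i, 0 < w i) (hA : ∀ i j, i ≠ j → 0 ≤ A i j)
    (hAw : A *ᵥ w = (-c) • w) (hAv : Aᵀ *ᵥ v = (-c) • v)
    (hd : ∀ i, d i * Δ i ≤ |d i| * (A *ᵥ fun j => |d j|) i) :
    weakPairing 1 (Matrix.diagonal (perronWeight 1 q v w)) Δ d ≤
      -c * weightedNorm 1 (Matrix.diagonal (perronWeight 1 q v w)) d ^ 2 := by
  have hwd : (w * fun j => |d j| / w j) = fun j => |d j| :=
    funext fun j => mul_div_cancel₀ _ (hw j).ne'
  have hN := weightedNorm_perronWeight_rpow le_rfl ENNReal.one_ne_top hq hv hw d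
  have hM := sum_rpow_mul_metzler_mulVec_le hA (fun i => (hv i).le) (fun i => (hw i).le) hAw hAv
    le_rfl (s := fun j => |d j| / w j) (fun i => div_nonneg (abs_nonneg _) (hw i).le)
  have hη : ∀ i, perronWeight 1 q v w i = v i := fun i => by
    have := perronWeight_rpow le_rfl ENNReal.one_ne_top hq hv hw i
    simpa using this
  rw [hwd] at hM
  simp only [ENNReal.toReal_one, Real.rpow_one] at hN
  simp only [sub_self, Real.rpow_zero, mul_one, Real.rpow_one, ← hN] at hM
  rw [weakPairing, if_pos rfl, sq, mul_left_comm]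
  refine mul_le_mul_of_nonneg_left (le_trans (Finset.sum_le_sum fun i _ => ?_) hM)
    (weightedNorm_nonneg le_rfl _ _)
  rw [Matrix.mulVec_diagonal, Matrix.mulVec_diagonal, hη, mul_left_comm]
  refine mul_le_mul_of_nonneg_left ?_ (hv i).le
  rcases lt_trichotomy (d i) 0 with h | h | h
  · have h1 := hd i
    rw [abs_of_neg h] at h1
    rw [Real.sign_of_neg (mul_neg_of_pos_of_neg (hv i) h)]
    nlinarith
  · rw [h, mul_zero, Real.sign_zero, zero_mul]
    change 0 ≤ ∑ j, A i j * |d j|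
    refine Finset.sum_nonneg fun j _ => ?_
    by_cases hij : i = j
    · simp [← hij, h]
    · exact mul_nonneg (hA i j hij) (abs_nonneg _)
  · have h1 := hd i
    rw [abs_of_pos h] at h1
    rw [Real.sign_of_pos (mul_pos (hv i) h), one_mul]
    exact le_of_mul_le_mul_left h1 h

/-- At an index where `|dᵢ| / wᵢ` attains its maximum `N`, the other coordinates of `|d|` may be
replaced by those of the eigenvector `N w`. -/
theorem weakPairing_top_perronWeight_le [Nonempty (Fin n)] (hq : 1 / ∞ + 1 / q = 1)
    (hw : ∀ i, 0 < w i) (hA : ∀ i j, i ≠ j → 0 ≤ A i j) (hAw : A *ᵥ w = (-c) • w)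
    (hd : ∀ i, d i * Δ i ≤ |d i| * (A *ᵥ fun j => |d j|) i) :
    weakPairing ∞ (Matrix.diagonal (perronWeight ∞ q v w)) Δ d ≤
      -c * weightedNorm ∞ (Matrix.diagonal (perronWeight ∞ q v w)) d ^ 2 := by
  rw [weakPairing, if_neg ENNReal.top_ne_one, if_pos rfl]
  obtain ⟨i₀, hi₀⟩ := exists_abs_eq_weightedNorm_top
    (Matrix.diagonal (perronWeight ∞ q v w)) d
  -- The maximum is over a nonempty set of indices, so the supremum has no default value.
  have : Nonempty {i : Fin n // |(Matrix.diagonal (perronWeight ∞ q v w) *ᵥ d) i| =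
    weightedNorm ∞ (Matrix.diagonal (perronWeight ∞ q v w)) d} := ⟨⟨i₀, hi₀⟩⟩
  refine ciSup_le fun ⟨i, hi⟩ => ?_
  have hle := fun j => abs_le_weightedNorm_top (η := perronWeight ∞ q v w) (x := d) j
  have hN := weightedNorm_nonneg le_top (Matrix.diagonal (perronWeight ∞ q v w)) d
  set N := weightedNorm ∞ (Matrix.diagonal (perronWeight ∞ q v w)) d
  simp only [Matrix.mulVec_diagonal, perronWeight_top hq, one_div_mul_eq_div, abs_div,
    abs_of_pos (hw _), div_le_iff₀ (hw _)] at hi hle ⊢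
  rw [div_eq_iff (hw i).ne'] at hi
  have hrow : ∑ j, A i j * w j = -c * w i := congrFun hAw i
  have hAd : (A *ᵥ fun j => |d j|) i ≤ -c * (N * w i) := by
    calc (A *ᵥ fun j => |d j|) i = ∑ j, A i j * |d j| := rfl
      _ ≤ ∑ j, A i j * (N * w j) := by
          refine Finset.sum_le_sum fun j _ => ?_
          by_cases hij : i = j
          · rw [← hij, hi]
          · exact mul_le_mul_of_nonneg_left (hle j) (hA i j hij)
      _ = N * ∑ j, A i j * w j := by
          rw [Finset.mul_sum]
          exact Finset.sum_congr rfl fun j _ => by ring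
      _ = _ := by rw [hrow]; ring
  have hwi := hw i
  rw [div_mul_div_comm, div_le_iff₀ (mul_pos hwi hwi)]
  calc d i * Δ i ≤ |d i| * (A *ᵥ fun j => |d j|) i := hd i
    _ ≤ (N * w i) * (-c * (N * w i)) := by
        rw [hi]
        exact mul_le_mul_of_nonneg_left hAd (mul_nonneg hN hwi.le)
    _ = _ := by ring

theorem weakPairing_finite_perronWeight_le (hp : 1 < p) (hpt : p ≠ ∞) (hpq : 1 / p + 1 / q = 1)
    (hv : ∀ i, 0 < v i) (hw : ∀ i, 0 < w i) (hA : ∀ i j, i ≠ j → 0 ≤ A i j)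
    (hAw : A *ᵥ w = (-c) • w) (hAv : Aᵀ *ᵥ v = (-c) • v)
    (hd : ∀ i, d i * Δ i ≤ |d i| * (A *ᵥ fun j => |d j|) i) :
    weakPairing p (Matrix.diagonal (perronWeight p q v w)) Δ d ≤
      -c * weightedNorm p (Matrix.diagonal (perronWeight p q v w)) d ^ 2 := by
  have hP : 1 ≤ p.toReal := by
    simpa using (ENNReal.toReal_le_toReal ENNReal.one_ne_top hpt).2 hp.le
  have hη := fun i => perronWeight_pos (p := p) (q := q) hv hw i
  have hηP := perronWeight_rpow hp.le hpt hpq hv hw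
  have hN := weightedNorm_perronWeight_rpow hp.le hpt hpq hv hw d
  have hN0 := weightedNorm_nonneg hp.le (Matrix.diagonal (perronWeight p q v w)) d
  have hM := sum_rpow_mul_metzler_mulVec_le hA (fun i => (hv i).le) (fun i => (hw i).le) hAw hAv
    hP (s := fun j => |d j| / w j) (fun i => div_nonneg (abs_nonneg _) (hw i).le)
  have hwd : (w * fun j => |d j| / w j) = fun j => |d j| :=
    funext fun j => mul_div_cancel₀ _ (hw j).ne'
  rw [hwd, ← hN] at hM
  rw [weakPairing, if_neg hp.ne', if_neg hpt]
  simp only [Matrix.mulVec_diagonal]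
  by_cases hd0 : d = 0
  · simp [hd0, weightedNorm, PiLp.norm_eq_sum (lt_of_lt_of_le one_pos hP),
      Real.zero_rpow (by linarith : p.toReal ≠ 0),
      Real.zero_rpow (by simp; linarith : p.toReal⁻¹ ≠ 0)]
  set N := weightedNorm p (Matrix.diagonal (perronWeight p q v w)) d with hNdef
  have hNpos : 0 < N := by
    refine hN0.lt_of_ne fun h => hd0 ?_
    have : Fact (1 ≤ p) := ⟨hp.le⟩
    obtain ⟨S, hS⟩ := exists_continuousLinearEquiv_weightedNorm (p := p) hη
    rw [hNdef, hS, eq_comm, norm_eq_zero, map_eq_zero_iff _ S.injective] at h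
    exact h
  have hN2 : N ^ (2 - p.toReal) * N ^ p.toReal = N ^ 2 := by
    rw [← Real.rpow_add hNpos, sub_add_cancel, Real.rpow_two]
  rw [← hN2, mul_left_comm]
  refine mul_le_mul_of_nonneg_left (le_trans (Finset.sum_le_sum fun i _ => ?_) hM)
    (Real.rpow_nonneg hN0 _)
  by_cases hdi : d i = 0
  · have : p.toReal - 1 ≠ 0 := by
      have := (ENNReal.toReal_lt_toReal ENNReal.one_ne_top hpt).2 hp
      rw [ENNReal.toReal_one] at this
      linarith
    simp [hdi, Real.zero_rpow this]
  have hdpos : 0 < |d i| := abs_pos.2 hdi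
  have h1 : perronWeight p q v w i * d i * |perronWeight p q v w i * d i| ^ (p.toReal - 2) *
      (perronWeight p q v w i * Δ i) =
      perronWeight p q v w i ^ p.toReal * |d i| ^ (p.toReal - 2) * (d i * Δ i) := by
    rw [abs_mul, abs_of_pos (hη i), Real.mul_rpow (hη i).le hdpos.le, Real.rpow_sub (hη i),
      Real.rpow_two]
    have := (hη i).ne'
    field_simp
  have h2 : v i * (|d i| / w i) ^ (p.toReal - 1) =
      perronWeight p q v w i ^ p.toReal * |d i| ^ (p.toReal - 2) * |d i| := by
    rw [hηP, Real.div_rpow hdpos.le (hw i).le, mul_assoc, ← Real.rpow_add_one hdpos.ne']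
    ring_nf
  rw [h1, h2, mul_assoc _ |d i|]
  exact mul_le_mul_of_nonneg_left (hd i)
    (mul_nonneg (Real.rpow_nonneg (hη i).le _) (Real.rpow_nonneg hdpos.le _))

theorem weakPairing_perronWeight_le [Nonempty (Fin n)] (hp : 1 ≤ p) (hpq : 1 / p + 1 / q = 1)
    (hv : ∀ i, 0 < v i) (hw : ∀ i, 0 < w i) (hA : ∀ i j, i ≠ j → 0 ≤ A i j)
    (hAw : A *ᵥ w = (-c) • w) (hAv : Aᵀ *ᵥ v = (-c) • v)
    (hd : ∀ i, d i * Δ i ≤ |d i| * (A *ᵥ fun j => |d j|) i) :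
    weakPairing p (Matrix.diagonal (perronWeight p q v w)) Δ d ≤
      -c * weightedNorm p (Matrix.diagonal (perronWeight p q v w)) d ^ 2 := by
  rcases hp.eq_or_lt with rfl | hp1
  · exact weakPairing_one_perronWeight_le hpq hv hw hA hAw hAv hd
  · by_cases hpt : p = ∞
    · subst hpt
      exact weakPairing_top_perronWeight_le hpq hw hA hAw hd
    · exact weakPairing_finite_perronWeight_le hp1 hpt hpq hv hw hA hAw hAv hd

end Metzler

/-! ### The Hopfield vector field -/

section Hopfield

variable {n : ℕ} {lam : Fin n → ℝ} {T : Matrix (Fin n) (Fin n) ℝ} {g : Fin n → ℝ → ℝ}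
  {Gbar : Fin n → ℝ} {I : ℝ≥0 → Fin n → ℝ}

theorem IsActivation.abs_sub_le {f : ℝ → ℝ} {G : ℝ} (hf : IsActivation f G) (x y : ℝ) :
    |f x - f y| ≤ G * |x - y| := by
  by_cases h : x = y
  · simp [h]
  have hs := hf.sector x y h
  rw [← div_le_iff₀ (abs_pos.2 (sub_ne_zero.2 h)), ← abs_div, abs_of_nonneg hs.1]
  exact hs.2

theorem neg_diagonal_add_mul_diagonal_mulVec (u : Fin n → ℝ) (i : Fin n) :
    ((-Matrix.diagonal lam + T * Matrix.diagonal Gbar) *ᵥ u) i =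
      -(lam i * u i) + ∑ j, T i j * (Gbar j * u j) := by
  rw [Matrix.add_mulVec, Matrix.neg_mulVec, ← Matrix.mulVec_mulVec, Pi.add_apply, Pi.neg_apply,
    Matrix.mulVec_diagonal]
  simp [Matrix.mulVec, dotProduct, Matrix.diagonal_apply]

theorem neg_diagonal_add_mul_diagonal_apply_ne {i j : Fin n} (hij : i ≠ j) :
    (-Matrix.diagonal lam + T * Matrix.diagonal Gbar) i j = T i j * Gbar j := by
  simp [Matrix.diagonal_apply_ne _ hij, Matrix.mul_diagonal]

theorem hopfield_sub_apply (t : ℝ≥0) (x y : Fin n → ℝ) (i : Fin n) :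
    (hopfield lam T g I t x - hopfield lam T g I t y) i =
      -(lam i * (x - y) i) + ∑ j, T i j * (g j (x j) - g j (y j)) := by
  simp only [hopfield, Pi.sub_apply, Pi.add_apply, Pi.neg_apply, Matrix.mulVec_diagonal]
  simp only [Matrix.mulVec, dotProduct, mul_sub, Finset.sum_sub_distrib]
  ring

theorem abs_sum_activation_sub_le (hT : ∀ i j, 0 ≤ T i j)
    (hg : ∀ i, IsActivation (g i) (Gbar i)) (x y : Fin n → ℝ) (i : Fin n) :
    |∑ j, T i j * (g j (x j) - g j (y j))| ≤ ∑ j, T i j * (Gbar j * |(x - y) j|) := by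
  refine (Finset.abs_sum_le_sum_abs _ _).trans (Finset.sum_le_sum fun j _ => ?_)
  rw [abs_mul, abs_of_nonneg (hT i j)]
  exact mul_le_mul_of_nonneg_left ((hg j).abs_sub_le _ _) (hT i j)

/-- The Metzler matrix `-Λ + T [Ḡ]` dominates the increments of the Hopfield vector field in the
direction of the increment of the state. -/
theorem sub_mul_hopfield_sub_le (hT : ∀ i j, 0 ≤ T i j)
    (hg : ∀ i, IsActivation (g i) (Gbar i)) (t : ℝ≥0) (x y : Fin n → ℝ) (i : Fin n) :
    (x - y) i * (hopfield lam T g I t x - hopfield lam T g I t y) i ≤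
      |(x - y) i| *
        ((-Matrix.diagonal lam + T * Matrix.diagonal Gbar) *ᵥ fun j => |(x - y) j|) i := by
  rw [hopfield_sub_apply, neg_diagonal_add_mul_diagonal_mulVec, mul_add, mul_add]
  refine add_le_add (le_of_eq ?_) ?_
  · have := abs_mul_abs_self ((x - y) i)
    linear_combination lam i * this
  · refine (le_abs_self _).trans ?_
    rw [abs_mul]
    exact mul_le_mul_of_nonneg_left (abs_sum_activation_sub_le hT hg x y i) (abs_nonneg _)

theorem abs_hopfield_euler_sub_le (hT : ∀ i j, 0 ≤ T i j)
    (hg : ∀ i, IsActivation (g i) (Gbar i)) (t : ℝ≥0) {h : ℝ} (hpos : 0 ≤ h) {i : Fin n}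
    (hle : h * lam i ≤ 1) (x y : Fin n → ℝ) :
    |((x + h • hopfield lam T g I t x) - (y + h • hopfield lam T g I t y)) i| ≤
      ((1 + h • (-Matrix.diagonal lam + T * Matrix.diagonal Gbar)) *ᵥ fun j => |(x - y) j|) i := by
  have h1 : ((x + h • hopfield lam T g I t x) - (y + h • hopfield lam T g I t y)) i =
      (1 - h * lam i) * (x - y) i + h * ∑ j, T i j * (g j (x j) - g j (y j)) := by
    have := hopfield_sub_apply (lam := lam) (T := T) (g := g) (I := I) t x y i
    simp only [Pi.sub_apply, Pi.add_apply, Pi.smul_apply, smul_eq_mul] at this ⊢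
    linear_combination h * this
  have h2 : ((1 + h • (-Matrix.diagonal lam + T * Matrix.diagonal Gbar)) *ᵥ
      fun j => |(x - y) j|) i =
      (1 - h * lam i) * |(x - y) i| + h * ∑ j, T i j * (Gbar j * |(x - y) j|) := by
    rw [Matrix.add_mulVec, Matrix.one_mulVec, Matrix.smul_mulVec, Pi.add_apply, Pi.smul_apply,
      neg_diagonal_add_mul_diagonal_mulVec, smul_eq_mul]
    ring
  rw [h1, h2]
  refine (abs_add_le _ _).trans (add_le_add (le_of_eq ?_) ?_)
  · rw [abs_mul, abs_of_nonneg (by linarith)]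
  · rw [abs_mul, abs_of_nonneg hpos]
    exact mul_le_mul_of_nonneg_left (abs_sum_activation_sub_le hT hg x y i) hpos

theorem exists_lipschitzWith_hopfield (hg : ∀ i, IsActivation (g i) (Gbar i)) (t : ℝ≥0) :
    ∃ K, LipschitzWith K (hopfield lam T g I t) := by
  have hG : ∀ i, 0 ≤ Gbar i := fun i => (hg i).bound_pos.le
  have hgL : LipschitzWith (∑ i, Gbar i).toNNReal
      (fun (x : Fin n → ℝ) i => g i (x i)) := by
    refine LipschitzWith.of_dist_le_mul fun x y => ?_
    rw [dist_pi_le_iff (by positivity), Real.coe_toNNReal _ (Finset.sum_nonneg fun i _ => hG i)]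
    intro i
    rw [Real.dist_eq]
    refine ((hg i).abs_sub_le _ _).trans ?_
    rw [← Real.dist_eq]
    exact mul_le_mul (Finset.single_le_sum (fun i _ => hG i) (Finset.mem_univ i))
      (dist_le_pi_dist x y i) dist_nonneg (Finset.sum_nonneg fun i _ => hG i)
  have hlin : ∀ M : Matrix (Fin n) (Fin n) ℝ, ∃ K, LipschitzWith K fun x => M *ᵥ x := fun M =>
    ⟨_, (LinearMap.toContinuousLinearMap M.mulVecLin).lipschitz⟩
  obtain ⟨K₁, h₁⟩ := hlin (Matrix.diagonal lam)
  obtain ⟨K₂, h₂⟩ := hlin T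
  exact ⟨_, (h₁.neg.add (h₂.comp hgL)).add (LipschitzWith.const (I t))⟩

end Hopfield

theorem mainTheorem5 {n : ℕ}
    -- dissipation rates, interaction matrix, activation functions and their bounds, input
    (lam : Fin n → ℝ) (hlam : ∀ i, 0 < lam i)
    (T : Matrix (Fin n) (Fin n) ℝ) (hT : ∀ i j, 0 ≤ T i j)
    -- `T` is irreducible: its digraph is strongly connected
    (hTirr : @Quiver.IsStronglyConnected (Fin n) T.toQuiver)
    (g : Fin n → ℝ → ℝ) (Gbar : Fin n → ℝ) (hg : ∀ i, IsActivation (g i) (Gbar i))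
    (I : ℝ≥0 → Fin n → ℝ) (hI : ∀ t i, 0 ≤ I t i)
    (hHurwitz : IsHurwitz (-Matrix.diagonal lam + T * Matrix.diagonal Gbar))
    (c : ℝ) (v w : Fin n → ℝ)
    (hv : IsLeftPerronPair (-Matrix.diagonal lam + T * Matrix.diagonal Gbar) (-c) v)
    (hw : IsRightPerronPair (-Matrix.diagonal lam + T * Matrix.diagonal Gbar) (-c) w)
    (p q : ℝ≥0∞) (hp : 1 ≤ p) (hq : 1 ≤ q) (hpq : 1 / p + 1 / q = 1) :
    (∀ i, 0 < perronWeight p q v w i) ∧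
    IsStronglyContracting (hopfield lam T g I) p
      (Matrix.diagonal (perronWeight p q v w)) c ∧
    (∀ Istar : Fin n → ℝ, (∀ t, I t = Istar) →
      ∃ xs : Fin n → ℝ,
        (∀ x, hopfield lam T g I 0 x = 0 ↔ x = xs) ∧
        IsGloballyExpStable (hopfield lam T g I 0) xs ∧
        IsGlobalExpLyapunov (hopfield lam T g I 0) xs c
          (fun x => weightedNorm p (Matrix.diagonal (perronWeight p q v w)) (x - xs)) ∧
        IsGlobalExpLyapunov (hopfield lam T g I 0) xs c
          (fun x => weightedNorm p (Matrix.diagonal (perronWeight p q v w))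
            (hopfield lam T g I 0 x))) := by
  set A := -Matrix.diagonal lam + T * Matrix.diagonal Gbar with hAdef
  have hA : ∀ i j, i ≠ j → 0 ≤ A i j := fun i j hij => by
    rw [hAdef, neg_diagonal_add_mul_diagonal_apply_ne hij]
    exact mul_nonneg (hT i j) (hg j).bound_pos.le
  have hTA : ∀ i j, i ≠ j → 0 < T i j → 0 < A i j := fun i j hij hij' => by
    rw [hAdef, neg_diagonal_add_mul_diagonal_apply_ne hij]
    exact mul_pos hij' (hg j).bound_pos
  have hvpos := hv.pos hTirr hA hTA
  have hwpos := hw.pos hTirr hA hTA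
  have hc : 0 < c := by simpa using hHurwitz _ hw.mem_spectrum
  have hAw : A *ᵥ w = (-c) • w := hw.eigen
  have hAv : Aᵀ *ᵥ v = (-c) • v := hv.eigen
  have hη := fun i => perronWeight_pos (p := p) (q := q) hvpos hwpos i
  have : Nonempty (Fin n) := by
    by_contra h
    rw [not_nonempty_iff] at h
    exact hw.ne_zero (Subsingleton.elim _ _)
  refine ⟨hη, ⟨hc, fun t x y => ?_⟩, fun _ _ => ?_⟩
  · exact weakPairing_perronWeight_le hp hpq hvpos hwpos hA hAw hAv
      (sub_mul_hopfield_sub_le hT hg t x y)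
  have : Fact (1 ≤ p) := ⟨hp⟩
  obtain ⟨S, hS⟩ := exists_continuousLinearEquiv_weightedNorm (p := p) hη
  obtain ⟨K, hK⟩ := exists_lipschitzWith_hopfield (lam := lam) (T := T) (I := I) hg 0
  simp only [hS]
  -- Steps this short keep `1 - c h` positive and `1 - h Λ`, hence `1 + h A`, nonnegative.
  set h₀ : ℝ := 1 / (1 + c + ∑ i, lam i) with hh₀def
  have hsum : 0 ≤ ∑ i, lam i := Finset.sum_nonneg fun i _ => (hlam i).le
  have hh₀ : 0 < h₀ := by positivity
  have hstep : ∀ h, 0 < h → h ≤ h₀ → ∀ x y,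
      ‖S ((x + h • hopfield lam T g I 0 x) - (y + h • hopfield lam T g I 0 y))‖ ≤
        (1 - c * h) * ‖S (x - y)‖ := by
    intro h hpos hle x y
    have hle1 : h * (1 + c + ∑ i, lam i) ≤ 1 := by
      rwa [hh₀def, le_div_iff₀ (by positivity)] at hle
    have hlami : ∀ i, h * lam i ≤ 1 := fun i => by
      have := Finset.single_le_sum (f := lam) (fun i _ => (hlam i).le) (Finset.mem_univ i)
      nlinarith
    rw [← hS, ← hS]
    refine weightedNorm_perronWeight_le_mul hp hpq hvpos hwpos (by nlinarith) (fun i j => ?_)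
      (one_add_smul_mulVec_eigen hAw h) (one_add_smul_transpose_mulVec_eigen hAv h)
      (fun i => abs_hopfield_euler_sub_le hT hg 0 hpos.le (hlami i) x y)
    by_cases hij : i = j
    · subst hij
      have h1 := mul_nonneg hpos.le (mul_nonneg (hT i i) (hg i).bound_pos.le)
      have h2 := hlami i
      simp only [hAdef, Matrix.add_apply, Matrix.one_apply_eq, Matrix.smul_apply, Matrix.neg_apply,
        Matrix.diagonal_apply_eq, Matrix.mul_diagonal, smul_eq_mul]
      linarith
    · simp only [Matrix.add_apply, Matrix.one_apply_ne hij, Matrix.smul_apply, smul_eq_mul,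
        zero_add]
      exact mul_nonneg hpos.le (hA i j hij)
  obtain ⟨xs, hxs⟩ := existsUnique_equilibrium_of_euler_contraction hc hh₀ (hstep h₀ hh₀ le_rfl)
  have hxs0 := (hxs xs).2 rfl
  have hV := isGlobalExpLyapunov_norm_sub_of_euler_contraction hc hh₀ hstep hxs0
  exact ⟨xs, hxs, isGloballyExpStable_of_isGlobalExpLyapunov hK hxs0 hV, hV,
    isGlobalExpLyapunov_norm_field_of_euler_contraction hc hh₀ hstep hK hxs0⟩
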